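/- Let $\Sigma_2=\{-1,+1\}^{\mathbb N}$ be the one-sided full shift with shift map $\sigma$, the product topology and its Borel $\sigma$-algebra. Let $\rho$ be the uniform law on $\{-1,+1\}$ and $\mathbb P=\rho^{\otimes\mathbb N}$. For a word $\omega=\omega_0\cdots\omega_{n-1}$ let $$H_n(\omega)=-\frac1{2n}\sum_{i,j=0}^{n-1}\omega_j\omega_i ,$$ and for $\beta>0$ let $\mu_{n,\beta}$ be the Curie--Weiss Gibbs measure on $\Sigma_2$, $$\mu_{n,\beta}(d\omega)=\frac{e^{-\beta H_n(\omega_0\cdots\omega_{n-1})}}{Z_{n,\beta}}\,\mathbb P(d\omega),\qquad Z_{n,\beta}=\frac1{2^n}\sum_{|\omega'|=n}e^{-\beta H_n(\omega')} .$$ For a continuous $\varphi:\Sigma_2\to\mathbb R$, an equilibrium state for $\varphi$ is a $\sigma$-invariant Borel probability measure attaining the supremum $\sup_\mu\{h_\mu+\int\varphi\,d\mu\}$ over all $\sigma$-invariant Borel probability measures $\mu$, where $h_\mu$ is the Kolmogorov--Sinai entropy; if there is exactly one equilibrium state for $\varphi$, it is called the dynamical Gibbs measure for $\varphi$. **Theorem.**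 Let $\beta>0$. 1. The function $\varphi_I(x)=\log(\cosh(\beta x))-\frac{\beta}{2}x^2$ attains its maximum over $[0,1]$ at a unique point $\xi_\beta$. 2. For every $b\in\mathbb R$ the function $b(\mathbf 1_{[+1]}-\mathbf 1_{[-1]})$, where $[\pm1]=\{x\in\Sigma_2: x_0=\pm1\}$, has a dynamical Gibbs measure $\widetilde\mu_b$. It is the Bernoulli product measure whose marginals give mass $e^{\pm b}/(e^b+e^{-b})$ to $\pm1$; in particular $\widetilde\mu_0=\mathbb P$. 3. As $n\to\infty$, $\mu_{n,\beta}$ converges weakly to $$\begin{cases}\widetilde\mu_0=\mathbb P & \text{if }\beta\le 1,\\[2pt] \frac12\left[\widetilde\mu_{\beta\xi_\beta}+\widetilde\mu_{-\beta\xi_\beta}\right] & \text{if }\beta>1.\end{cases}$$ -/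

import Mathlib

open MeasureTheory Filter Topology
open scoped ENNReal

/-! ### The alphabet `{-1, +1}` (the units of `ℤ`) and the one-sided full shift -/

instance Units.Int.instMeasurableSingletonClass : MeasurableSingletonClass ℤˣ where
  measurableSet_singleton u := by
    refine ⟨{(u : ℤ)}, MeasurableSet.singleton _, ?_⟩
    ext v
    simp [Units.ext_iff]

instance Units.Int.instBorelSpace : BorelSpace ℤˣ := by
  refine ⟨?_⟩
  rw [borel_eq_top_of_discrete]
  exact (MeasurableSpace.le_def.2 fun _ _ => trivial : _ ≤ ⊤).antisymm
    fun s _ => (Set.toFinite s).measurableSet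

namespace CurieWeiss

noncomputable section

/-- The full shift `{-1, +1}^ℕ`, with the product topology and its Borel σ-algebra. -/
abbrev Shift : Type := ℕ → ℤˣ

/-- The shift map `(σ x)_i = x_{i+1}`. -/
def shift (x : Shift) : Shift := fun i => x (i + 1)

/-- The cylinder `[w₀ … w_{n-1}]`. -/
def cyl {n : ℕ} (w : Fin n → ℤˣ) : Set Shift := {y | ∀ i : Fin n, y i = w i}

/-! ### Kolmogorov–Sinai entropy, pressure, equilibrium states -/

section Entropy

variable {X : Type*} [MeasurableSpace X]

/-- Shannon entropy `-∑ₐ μ(g = a) log μ(g = a)` of the finite partition into the fibres of `g`. -/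
def shannonEntropy {ι : Type*} [Fintype ι] (μ : Measure X) (g : X → ι) : ℝ :=
  ∑ a, Real.negMulLog (μ.real (g ⁻¹' {a}))

/-- The map whose fibres form the join `⋁_{i<n} T^{-i} P`, where `P` is the partition into the
fibres of `f`. -/
def itinerary {k : ℕ} (T : X → X) (f : X → Fin k) (n : ℕ) (x : X) : Fin n → Fin k :=
  fun i => f (T^[i] x)

/-- Entropy of `T` relative to the partition into the fibres of `f`: the limit of
`(1/n) H(⋁_{i<n} T^{-i} P)`, which exists by subadditivity when `T` preserves `μ`
(so that the `limsup` is the limit). -/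
def partitionEntropy {k : ℕ} (μ : Measure X) (T : X → X) (f : X → Fin k) : EReal :=
  limsup (fun n : ℕ => ((shannonEntropy μ (itinerary T f n) / n : ℝ) : EReal)) atTop

/-- The Kolmogorov–Sinai entropy: the supremum of the entropies relative to all finite measurable
partitions. -/
def ksEntropy (μ : Measure X) (T : X → X) : EReal :=
  ⨆ (k : ℕ) (f : X → Fin k) (_ : Measurable f), partitionEntropy μ T f

end Entropy

/-- The free energy `h_μ + ∫ φ dμ`. -/
def freeEnergy (φ : C(Shift, ℝ)) (μ : ProbabilityMeasure Shift) : EReal :=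
  ksEntropy (μ : Measure Shift) shift + ((∫ x, φ x ∂(μ : Measure Shift) : ℝ) : EReal)

/-- `μ` is invariant under the shift. -/
def IsShiftInvariant (μ : ProbabilityMeasure Shift) : Prop :=
  MeasurePreserving shift (μ : Measure Shift) (μ : Measure Shift)

/-- The pressure: the supremum of the free energy over the shift-invariant probabilities. -/
def pressure (φ : C(Shift, ℝ)) : EReal :=
  ⨆ (μ : ProbabilityMeasure Shift) (_ : IsShiftInvariant μ), freeEnergy φ μ

/-- An equilibrium state for `φ`: an invariant probability attaining the pressure. -/
def IsEquilibriumState (φ : C(Shift, ℝ)) (μ : ProbabilityMeasure Shift) : Prop :=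
  IsShiftInvariant μ ∧ freeEnergy φ μ = pressure φ

/-- `μ` is the dynamical Gibbs measure for `φ`: the unique equilibrium state. -/
def IsDynamicalGibbsMeasure (φ : C(Shift, ℝ)) (μ : ProbabilityMeasure Shift) : Prop :=
  IsEquilibriumState φ μ ∧ ∀ ν, IsEquilibriumState φ ν → ν = μ

theorem isClopen_cyl {n : ℕ} (w : Fin n → ℤˣ) : IsClopen (cyl w) := by
  have h : cyl w = ⋂ i : Fin n, (fun y : Shift => y i) ⁻¹' {w i} := by
    ext y; simp [cyl]
  rw [h]
  exact isClopen_iInter_of_finite fun i =>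
    (isClopen_discrete {w i}).preimage (continuous_apply (i : ℕ))

/-- The function `ψ = 1_{[+1]} - 1_{[-1]}`. -/
def psi : C(Shift, ℝ) where
  toFun x := (cyl ![1]).indicator (fun _ => 1) x - (cyl ![-1]).indicator (fun _ => 1) x
  continuous_toFun :=
    ((isClopen_cyl _).continuous_indicator continuous_const).sub
      ((isClopen_cyl _).continuous_indicator continuous_const)

/-! ### The Curie–Weiss model -/

/-- The Curie–Weiss Hamiltonian `H_n(ω) = -(1/(2n)) ∑_{i,j<n} ω_j ω_i`. -/
def hamiltonian {n : ℕ} (w : Fin n → ℤˣ) : ℝ :=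
  -(1 / (2 * (n : ℝ))) * ∑ i, ∑ j, ((w j : ℤ) : ℝ) * ((w i : ℤ) : ℝ)

/-- The law on `{-1, +1}` with weights proportional to `e^b` and `e^{-b}`. -/
def spinLaw (b : ℝ) : Measure ℤˣ :=
  ENNReal.ofReal (Real.exp b / (Real.exp b + Real.exp (-b))) • Measure.dirac 1 +
    ENNReal.ofReal (Real.exp (-b) / (Real.exp b + Real.exp (-b))) • Measure.dirac (-1)

instance isProbabilityMeasure_spinLaw (b : ℝ) : IsProbabilityMeasure (spinLaw b) := by
  refine ⟨?_⟩
  have h : 0 < Real.exp b + Real.exp (-b) := by positivity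
  simp only [spinLaw, Measure.coe_add, Measure.coe_smul, Pi.add_apply, Pi.smul_apply,
    measure_univ, smul_eq_mul, mul_one]
  rw [← ENNReal.ofReal_add (by positivity) (by positivity), ← add_div, div_self h.ne',
    ENNReal.ofReal_one]

/-- The Bernoulli (product) measure on the shift with marginals `spinLaw b`. -/
def bernoulli (b : ℝ) : ProbabilityMeasure Shift :=
  ⟨Measure.infinitePi fun _ => spinLaw b, inferInstance⟩

/-- The uniform law `ρ` on `{-1, +1}`. -/
def rho : Measure ℤˣ :=
  (2⁻¹ : ℝ≥0∞) • Measure.dirac 1 + (2⁻¹ : ℝ≥0∞) • Measure.dirac (-1)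

instance isProbabilityMeasure_rho : IsProbabilityMeasure rho := by
  refine ⟨?_⟩
  simp [rho, ENNReal.inv_two_add_inv_two]

/-- The uniform Bernoulli measure `ℙ = ρ^{⊗ℕ}`. -/
def unif : ProbabilityMeasure Shift := ⟨Measure.infinitePi fun _ => rho, inferInstance⟩

/-- The prefix `ω₀ … ω_{n-1}` of an infinite word. -/
def pre (n : ℕ) (ω : Shift) : Fin n → ℤˣ := fun i => ω i

/-- The normalization `Z_{n,β} = 2^{-n} ∑_{|w| = n} e^{-β H_n(w)}`. -/
def partitionFunction (n : ℕ) (β : ℝ) : ℝ :=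
  1 / 2 ^ n * ∑ w : Fin n → ℤˣ, Real.exp (-β * hamiltonian w)

/-- The measure `(e^{-β H_n} / Z_{n,β}) dℙ`. -/
def gibbsAux (n : ℕ) (β : ℝ) : Measure Shift :=
  (unif : Measure Shift).withDensity fun ω =>
    ENNReal.ofReal (Real.exp (-β * hamiltonian (pre n ω)) / partitionFunction n β)

theorem measurable_pre (n : ℕ) : Measurable (pre n) :=
  measurable_pi_lambda _ fun i => measurable_pi_apply (i : ℕ)

theorem rho_singleton (u : ℤˣ) : rho {u} = 2⁻¹ := by
  rcases Int.units_eq_one_or u with rfl | rfl <;> simp [rho, Set.indicator]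

theorem unif_pre (n : ℕ) (w : Fin n → ℤˣ) :
    (unif : Measure Shift) (pre n ⁻¹' {w}) = 2⁻¹ ^ n := by
  have h : pre n ⁻¹' {w} =
      Set.pi (Finset.range n : Set ℕ) (fun i => if hi : i < n then {w ⟨i, hi⟩} else Set.univ) := by
    ext y
    simp only [Set.mem_preimage, Set.mem_singleton_iff, funext_iff, pre, Set.mem_pi,
      Finset.coe_range, Set.mem_Iio]
    constructor
    · intro hy i hi
      simpa [hi] using hy ⟨i, hi⟩
    · intro hy i
      simpa [i.2] using hy i i.2
  change Measure.infinitePi (fun _ => rho) _ = _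
  rw [h, Measure.infinitePi_pi, Finset.prod_congr rfl (g := fun _ => (2⁻¹ : ℝ≥0∞))]
  · simp
  · intro i hi
    rw [dif_pos (Finset.mem_range.1 hi), rho_singleton]
  · intro i _
    exact (Set.toFinite _).measurableSet

instance isProbabilityMeasure_gibbsAux (n : ℕ) (β : ℝ) :
    IsProbabilityMeasure (gibbsAux n β) := by
  have hsum : 0 < ∑ w : Fin n → ℤˣ, Real.exp (-β * hamiltonian w) :=
    Finset.sum_pos (fun _ _ => Real.exp_pos _) Finset.univ_nonempty
  have hZ : 0 < partitionFunction n β := by unfold partitionFunction; positivity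
  refine ⟨?_⟩
  let F : (Fin n → ℤˣ) → ℝ≥0∞ := fun w =>
    ENNReal.ofReal (Real.exp (-β * hamiltonian w) / partitionFunction n β)
  have hm : ∀ w : Fin n → ℤˣ,
      ((unif : Measure Shift).map (pre n)) {w} = ENNReal.ofReal (1 / 2 ^ n) := by
    intro w
    rw [Measure.map_apply (measurable_pre n) (MeasurableSet.singleton w), unif_pre,
      one_div, ENNReal.ofReal_inv_of_pos (by positivity),
      ENNReal.ofReal_pow (by norm_num), ENNReal.inv_pow]
    simp
  calc gibbsAux n β Set.univ = ∫⁻ ω, F (pre n ω) ∂(unif : Measure Shift) := by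
        rw [gibbsAux, withDensity_apply _ MeasurableSet.univ, Measure.restrict_univ]
    _ = ∫⁻ w, F w ∂((unif : Measure Shift).map (pre n)) :=
        (lintegral_map (measurable_of_finite F) (measurable_pre n)).symm
    _ = ∑ w, F w * ENNReal.ofReal (1 / 2 ^ n) := by
        rw [lintegral_fintype]
        exact Finset.sum_congr rfl fun w _ => by rw [hm]
    _ = 1 := by
        simp only [F]
        simp_rw [← ENNReal.ofReal_mul (div_nonneg (Real.exp_pos _).le hZ.le)]
        rw [← ENNReal.ofReal_sum_of_nonneg fun w _ =>
          mul_nonneg (div_nonneg (Real.exp_pos _).le hZ.le) (by positivity)]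
        rw [← Finset.sum_mul, ← Finset.sum_div, partitionFunction, ENNReal.ofReal_eq_one]
        field_simp

/-- The probabilistic Gibbs measure `μ_{n,β}` on the shift. -/
def gibbs (n : ℕ) (β : ℝ) : ProbabilityMeasure Shift := ⟨gibbsAux n β, inferInstance⟩

/-- The function `x ↦ log (cosh (β x)) - (β/2) x²`. -/
def phiI (β x : ℝ) : ℝ := Real.log (Real.cosh (β * x)) - β / 2 * x ^ 2

/-- The mixture `½ (μ + ν)`. -/
def halfSum (μ ν : ProbabilityMeasure Shift) : ProbabilityMeasure Shift :=
  ⟨(2⁻¹ : ℝ≥0∞) • ((μ : Measure Shift) + (ν : Measure Shift)), ⟨by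
    simp [ENNReal.inv_two_add_inv_two]⟩⟩

end

end CurieWeiss

/-!
For a shift-invariant `ν`, the coordinate at `0` generates, so the Kolmogorov–Sinai theorem gives
`h_ν = lim H_n(ν)/n = inf H_n(ν)/n`, where `H_n(ν)` is the entropy of the first `n` coordinates.
Comparing their law with the one under `bernoulli b` yields the identity
`H_n(ν) + D_n(ν ‖ bernoulli b) = n (log (2 cosh b) - b ∫ ψ dν)`. As the relative entropy `D_n` is
nonnegative and vanishes only for equal laws, the pressure of `b ψ` is `log (2 cosh b)`, attained
exactly at `bernoulli b`.

Completing the square (the Hubbard–Stratonovich transform) writes the law of the first `n` spins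
under `gibbs n β` as the mixture of the `bernoulli (β x)` with density in `x` proportional to
`exp (n * phiI β x)`. By Laplace's method the mixing density concentrates on the maximizers `±ξ` of
`phiI β`, with equal weights by symmetry. They are the only ones because `u ↦ phiI β √u` is strictly
concave.
-/

namespace CurieWeiss

/-! ### Shannon entropy -/

section RelativeEntropy

variable {ι : Type*} [Fintype ι] {p q : ι → ℝ}

/-- The relative entropy of `p` with respect to `q`, written with `klFun x = x log x + 1 - x` so
that every summand is nonnegative; for families of equal total mass it is `∑ᵢ pᵢ log (pᵢ / qᵢ)`. -/
noncomputable def relEntropy (p q : ι → ℝ) : ℝ := ∑ i, q i * InformationTheory.klFun (p i / q i)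

theorem relEntropy_nonneg (hp : ∀ i, 0 ≤ p i) (hq : ∀ i, 0 ≤ q i) : 0 ≤ relEntropy p q :=
  Finset.sum_nonneg fun i _ =>
    mul_nonneg (hq i) (InformationTheory.klFun_nonneg (div_nonneg (hp i) (hq i)))

theorem relEntropy_eq_zero_iff (hp : ∀ i, 0 ≤ p i) (hq : ∀ i, 0 < q i) :
    relEntropy p q = 0 ↔ p = q := by
  have hr : ∀ i, 0 ≤ p i / q i := fun i => div_nonneg (hp i) (hq i).le
  rw [relEntropy, Finset.sum_eq_zero_iff_of_nonneg fun i _ =>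
    mul_nonneg (hq i).le (InformationTheory.klFun_nonneg (hr i)), funext_iff]
  refine forall_congr' fun i => ?_
  simp [(hq i).ne', InformationTheory.klFun_eq_zero_iff (hr i), div_eq_one_iff_eq]

theorem sum_negMulLog_add_relEntropy (hsum : ∑ i, p i = ∑ i, q i) (h : ∀ i, q i = 0 → p i = 0) :
    ∑ i, Real.negMulLog (p i) + relEntropy p q = -∑ i, p i * Real.log (q i) := by
  have hterm : ∀ i, Real.negMulLog (p i) + q i * InformationTheory.klFun (p i / q i) =
      -(p i * Real.log (q i)) + (q i - p i) := fun i => by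
    rcases eq_or_ne (q i) 0 with hq | hq
    · simp [hq, h i hq]
    rcases eq_or_ne (p i) 0 with hp | hp
    · simp [hp, InformationTheory.klFun_zero]
    rw [InformationTheory.klFun_apply, Real.log_div hp hq, Real.negMulLog]
    field_simp
    ring
  rw [relEntropy, ← Finset.sum_add_distrib, Finset.sum_congr rfl fun i _ => hterm i,
    Finset.sum_add_distrib, Finset.sum_sub_distrib, hsum, sub_self, add_zero,
    Finset.sum_neg_distrib]

theorem negMulLog_sum_le {ι : Type*} (s : Finset ι) {p : ι → ℝ} (hp : ∀ i, 0 ≤ p i) :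
    Real.negMulLog (∑ i ∈ s, p i) ≤ ∑ i ∈ s, Real.negMulLog (p i) := by
  rw [Real.negMulLog, ← Finset.sum_neg_distrib, Finset.sum_mul]
  refine Finset.sum_le_sum fun i hi => ?_
  rcases (hp i).eq_or_lt with h0 | h0
  · simp [← h0]
  have hlog := Real.log_le_log h0 (Finset.single_le_sum (fun j _ => hp j) hi)
  rw [Real.negMulLog, neg_mul, neg_mul, neg_le_neg_iff]
  exact mul_le_mul_of_nonneg_left hlog h0.le

end RelativeEntropy

section Shannon

variable {X : Type*} [MeasurableSpace X] {μ : Measure X}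
  {ι : Type*} [Fintype ι] [MeasurableSpace ι] [MeasurableSingletonClass ι]
  {κ : Type*} [Fintype κ] [MeasurableSpace κ] [MeasurableSingletonClass κ]
  {f : X → ι} {g : X → κ}

theorem integral_comp_eq_sum [IsFiniteMeasure μ] (hf : Measurable f) (F : ι → ℝ) :
    ∫ x, F (f x) ∂μ = ∑ a, μ.real (f ⁻¹' {a}) * F a := by
  rw [← integral_map hf.aemeasurable (measurable_of_finite F).aestronglyMeasurable,
    integral_fintype (Integrable.of_finite)]
  refine Finset.sum_congr rfl fun a _ => ?_
  rw [map_measureReal_apply hf (measurableSet_singleton a), smul_eq_mul]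

theorem shannonEntropy_comp_measurePreserving {T : X → X} (hT : MeasurePreserving T μ μ)
    (hf : Measurable f) : shannonEntropy μ (f ∘ T) = shannonEntropy μ f := by
  refine Finset.sum_congr rfl fun a _ => ?_
  rw [Set.preimage_comp,
    hT.measureReal_preimage (hf (measurableSet_singleton a)).nullMeasurableSet]

variable [IsProbabilityMeasure μ]

theorem sum_measureReal_preimage (hf : Measurable f) : ∑ a, μ.real (f ⁻¹' {a}) = 1 := by
  simpa using (integral_comp_eq_sum (μ := μ) hf fun _ => 1).symm

theorem shannonEntropy_nonneg {ι : Type*} [Fintype ι] (f : X → ι) : 0 ≤ shannonEntropy μ f :=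
  Finset.sum_nonneg fun _ _ => Real.negMulLog_nonneg measureReal_nonneg measureReal_le_one

theorem shannonEntropy_comp_le {κ : Type*} [Fintype κ] (hf : Measurable f) (φ : ι → κ) :
    shannonEntropy μ (φ ∘ f) ≤ shannonEntropy μ f := by
  classical
  have hfiber : ∀ b, μ.real ((φ ∘ f) ⁻¹' {b}) = ∑ a with φ a = b, μ.real (f ⁻¹' {a}) := fun b => by
    rw [sum_measureReal_preimage_singleton _ fun a _ => hf (measurableSet_singleton a)]
    congr 1
    ext x
    simp
  unfold shannonEntropy
  rw [← Finset.sum_fiberwise (s := Finset.univ) φ]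
  refine Finset.sum_le_sum fun b _ => ?_
  rw [hfiber]
  exact negMulLog_sum_le _ fun _ => measureReal_nonneg

/-- The defect is the mutual information of `f` and `g`, a relative entropy. -/
theorem shannonEntropy_prodMk_add_relEntropy (hf : Measurable f) (hg : Measurable g) :
    shannonEntropy μ (fun x => (f x, g x)) +
        relEntropy (fun c : ι × κ => μ.real ((fun x => (f x, g x)) ⁻¹' {c}))
          (fun c => μ.real (f ⁻¹' {c.1}) * μ.real (g ⁻¹' {c.2})) =
      shannonEntropy μ f + shannonEntropy μ g := by
  set P : ι × κ → ℝ := fun c => μ.real ((fun x => (f x, g x)) ⁻¹' {c})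
  set p : ι → ℝ := fun a => μ.real (f ⁻¹' {a})
  set q : κ → ℝ := fun b => μ.real (g ⁻¹' {b})
  have hfg : Measurable fun x => (f x, g x) := hf.prodMk hg
  have hPp : ∀ c, p c.1 = 0 → P c = 0 := fun c h =>
    measureReal_mono_null (fun x hx => congrArg Prod.fst hx) h
  have hPq : ∀ c, q c.2 = 0 → P c = 0 := fun c h =>
    measureReal_mono_null (fun x hx => congrArg Prod.snd hx) h
  have hmass : ∑ c, P c = ∑ c : ι × κ, p c.1 * q c.2 := by
    rw [sum_measureReal_preimage hfg, Fintype.sum_prod_type]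
    simp only [← Finset.mul_sum, ← Finset.sum_mul, p, q]
    rw [sum_measureReal_preimage hf, sum_measureReal_preimage hg, one_mul]
  have hlog : ∀ c : ι × κ, P c * Real.log (p c.1 * q c.2) =
      P c * Real.log (p c.1) + P c * Real.log (q c.2) := fun c => by
    by_cases hP : P c = 0
    · simp [hP]
    · rw [Real.log_mul (mt (hPp c) hP) (mt (hPq c) hP), mul_add]
  calc shannonEntropy μ (fun x => (f x, g x)) + relEntropy P (fun c => p c.1 * q c.2)
      = -∑ c, P c * Real.log (p c.1 * q c.2) :=
        sum_negMulLog_add_relEntropy hmass fun c hc =>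
          (mul_eq_zero.1 hc).elim (hPp c) (hPq c)
    _ = -(∫ x, Real.log (p (f x)) ∂μ + ∫ x, Real.log (q (g x)) ∂μ) := by
        rw [Finset.sum_congr rfl fun c _ => hlog c, Finset.sum_add_distrib,
          ← integral_comp_eq_sum hfg fun c => Real.log (p c.1),
          ← integral_comp_eq_sum hfg fun c => Real.log (q c.2)]
    _ = shannonEntropy μ f + shannonEntropy μ g := by
        rw [integral_comp_eq_sum hf fun a => Real.log (p a),
          integral_comp_eq_sum hg fun b => Real.log (q b)]
        simp only [shannonEntropy, Real.negMulLog, neg_mul, Finset.sum_neg_distrib, neg_add, p, q]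

theorem shannonEntropy_prodMk_le (hf : Measurable f) (hg : Measurable g) :
    shannonEntropy μ (fun x => (f x, g x)) ≤ shannonEntropy μ f + shannonEntropy μ g := by
  rw [← shannonEntropy_prodMk_add_relEntropy hf hg]
  exact le_add_of_nonneg_right <| relEntropy_nonneg (fun _ => measureReal_nonneg)
    fun _ => mul_nonneg measureReal_nonneg measureReal_nonneg

theorem tendsto_shannonEntropy_zero {J : Type*} {l : Filter J} {f : J → X → ι}
    (hf : ∀ j, Measurable (f j)) (a₀ : ι)
    (h : Tendsto (fun j => μ.real {x | f j x ≠ a₀}) l (𝓝 0)) :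
    Tendsto (fun j => shannonEntropy μ (f j)) l (𝓝 0) := by
  rw [← Finset.sum_const_zero (s := (Finset.univ : Finset ι))]
  refine tendsto_finsetSum _ fun a _ => ?_
  rcases eq_or_ne a a₀ with rfl | ha
  · have hmass : Tendsto (fun j => μ.real (f j ⁻¹' {a})) l (𝓝 1) := by
      have hcompl : ∀ j, μ.real (f j ⁻¹' {a}) = 1 - μ.real {x | f j x ≠ a} := fun j =>
        eq_sub_of_add_eq (probReal_add_probReal_compl (hf j (measurableSet_singleton a)))
      simpa only [hcompl, sub_zero] using h.const_sub 1
    simpa [Function.comp_def] using (Real.continuous_negMulLog.tendsto 1).comp hmass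
  · have hmass : Tendsto (fun j => μ.real (f j ⁻¹' {a})) l (𝓝 0) :=
      squeeze_zero (fun _ => measureReal_nonneg)
        (fun j => measureReal_mono fun x hx => (Set.mem_singleton_iff.1 hx).trans_ne ha) h
    simpa [Function.comp_def] using (Real.continuous_negMulLog.tendsto 0).comp hmass

end Shannon

/-! ### The Kolmogorov–Sinai generator theorem -/

section EntropyRate

variable {X : Type*} {ι κ : Type*} {T : X → X} {f : X → ι} {g : X → κ}

/-- The word `f x, f (T x), …, f (T^{n-1} x)`: the `itinerary` over an arbitrary alphabet. -/
def orbitWord (T : X → X) (f : X → ι) (n : ℕ) (x : X) : Fin n → ι := fun i => f (T^[i] x)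

theorem orbitWord_add (m n : ℕ) (x : X) :
    orbitWord T f (m + n) x = Fin.append (orbitWord T f m x) (orbitWord T f n (T^[m] x)) := by
  ext i
  refine Fin.addCases (fun j => ?_) (fun j => ?_) i
  · simp [orbitWord]
  · simp [orbitWord, ← Function.iterate_add_apply, add_comm]

/-- The entropy of `T` relative to the partition into the fibres of `f`, as the infimum to which
the averages `H(orbitWord T f n) / n` converge by Fekete's lemma. -/
noncomputable def entropyRate [MeasurableSpace X] [Fintype ι] (μ : Measure X) (T : X → X)
    (f : X → ι) : ℝ :=
  sInf ((fun n : ℕ => shannonEntropy μ (orbitWord T f n) / n) '' Set.Ici 1)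

variable [MeasurableSpace X] {μ : Measure X} [IsProbabilityMeasure μ]
  [Fintype ι] [MeasurableSpace ι] [MeasurableSingletonClass ι]
  [Fintype κ] [MeasurableSpace κ] [MeasurableSingletonClass κ]

theorem measurable_orbitWord {ι : Type*} [MeasurableSpace ι] {f : X → ι} (hT : Measurable T)
    (hf : Measurable f) (n : ℕ) : Measurable (orbitWord T f n) :=
  measurable_pi_lambda _ fun i => hf.comp (hT.iterate i)

theorem subadditive_shannonEntropy_orbitWord (hT : MeasurePreserving T μ μ) (hf : Measurable f) :
    Subadditive fun n => shannonEntropy μ (orbitWord T f n) := by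
  intro m n
  have hm := measurable_orbitWord hT.measurable hf m
  have hn := measurable_orbitWord hT.measurable hf n
  have hsplit : orbitWord T f (m + n) = (fun c : (Fin m → ι) × (Fin n → ι) => Fin.append c.1 c.2) ∘
      fun x => (orbitWord T f m x, (orbitWord T f n ∘ T^[m]) x) :=
    funext fun x => orbitWord_add m n x
  calc shannonEntropy μ (orbitWord T f (m + n))
      ≤ shannonEntropy μ fun x => (orbitWord T f m x, (orbitWord T f n ∘ T^[m]) x) :=
        hsplit ▸ shannonEntropy_comp_le (hm.prodMk (hn.comp (hT.measurable.iterate m))) _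
    _ ≤ shannonEntropy μ (orbitWord T f m) + shannonEntropy μ (orbitWord T f n ∘ T^[m]) :=
        shannonEntropy_prodMk_le hm (hn.comp (hT.measurable.iterate m))
    _ = shannonEntropy μ (orbitWord T f m) + shannonEntropy μ (orbitWord T f n) := by
        rw [shannonEntropy_comp_measurePreserving (hT.iterate m) hn]

theorem bddBelow_shannonEntropy_orbitWord_div {ι : Type*} [Fintype ι] (f : X → ι) :
    BddBelow (Set.range fun n : ℕ => shannonEntropy μ (orbitWord T f n) / n) :=
  ⟨0, Set.forall_mem_range.2 fun n => div_nonneg (shannonEntropy_nonneg _) n.cast_nonneg⟩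

theorem tendsto_entropyRate (hT : MeasurePreserving T μ μ) (hf : Measurable f) :
    Tendsto (fun n : ℕ => shannonEntropy μ (orbitWord T f n) / n) atTop
      (𝓝 (entropyRate μ T f)) := by
  have h := subadditive_shannonEntropy_orbitWord hT hf
  have hlim : h.lim = entropyRate μ T f := by rw [Subadditive.lim, entropyRate]
  exact hlim ▸ h.tendsto_lim (bddBelow_shannonEntropy_orbitWord_div f)

theorem mul_entropyRate_le {ι : Type*} [Fintype ι] (f : X → ι) (n : ℕ) :
    n * entropyRate μ T f ≤ shannonEntropy μ (orbitWord T f n) := by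
  rcases Nat.eq_zero_or_pos n with rfl | hn
  · simpa using shannonEntropy_nonneg _
  rw [← le_div_iff₀' (by positivity)]
  exact csInf_le ((bddBelow_shannonEntropy_orbitWord_div f).mono (Set.image_subset_range _ _))
    ⟨n, hn, rfl⟩

theorem entropyRate_le_shannonEntropy (hf : Measurable f) :
    entropyRate μ T f ≤ shannonEntropy μ f := by
  have hword : orbitWord T f 1 = (fun a (_ : Fin 1) => a) ∘ f := by
    ext x i
    simp [orbitWord, Subsingleton.elim i 0]
  calc entropyRate μ T f ≤ shannonEntropy μ (orbitWord T f 1) := by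
        simpa using mul_entropyRate_le (μ := μ) (T := T) f 1
    _ ≤ shannonEntropy μ f := hword ▸ shannonEntropy_comp_le hf _

theorem entropyRate_comp_le (hT : MeasurePreserving T μ μ) (hf : Measurable f) {φ : ι → κ} :
    entropyRate μ T (φ ∘ f) ≤ entropyRate μ T f :=
  le_of_tendsto_of_tendsto' (tendsto_entropyRate hT ((measurable_of_finite φ).comp hf))
    (tendsto_entropyRate hT hf) fun n => div_le_div_of_nonneg_right
      (shannonEntropy_comp_le (measurable_orbitWord hT.measurable hf n) fun w => φ ∘ w)
      n.cast_nonneg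

theorem entropyRate_prodMk_le (hT : MeasurePreserving T μ μ) (hf : Measurable f)
    (hg : Measurable g) :
    entropyRate μ T (fun x => (f x, g x)) ≤ entropyRate μ T f + entropyRate μ T g := by
  refine le_of_tendsto_of_tendsto' (tendsto_entropyRate hT (hf.prodMk hg))
    ((tendsto_entropyRate hT hf).add (tendsto_entropyRate hT hg)) fun n => ?_
  have hfn := measurable_orbitWord hT.measurable hf n
  have hgn := measurable_orbitWord hT.measurable hg n
  rw [← add_div]
  refine div_le_div_of_nonneg_right ?_ n.cast_nonneg
  calc shannonEntropy μ (orbitWord T (fun x => (f x, g x)) n)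
      ≤ shannonEntropy μ fun x => (orbitWord T f n x, orbitWord T g n x) :=
        shannonEntropy_comp_le (hfn.prodMk hgn)
          fun (c : (Fin n → ι) × (Fin n → κ)) i => (c.1 i, c.2 i)
    _ ≤ _ := shannonEntropy_prodMk_le hfn hgn

theorem entropyRate_le_add_sub {ι : Type*} [Fintype ι] [MeasurableSpace ι]
    [MeasurableSingletonClass ι] [AddGroup ι] {f g : X → ι} (hT : MeasurePreserving T μ μ)
    (hf : Measurable f) (hg : Measurable g) :
    entropyRate μ T f ≤ entropyRate μ T g + shannonEntropy μ fun x => f x - g x := by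
  have hsub : Measurable fun x => f x - g x :=
    (measurable_of_finite fun c : ι × ι => c.1 - c.2).comp (hf.prodMk hg)
  have hf_eq : f = (fun c : ι × ι => c.1 + c.2) ∘ fun x => (f x - g x, g x) := by
    ext x
    simp
  calc entropyRate μ T f ≤ entropyRate μ T fun x => (f x - g x, g x) := by
        conv_lhs => rw [hf_eq]
        exact entropyRate_comp_le hT (hsub.prodMk hg)
    _ ≤ entropyRate μ T (fun x => f x - g x) + entropyRate μ T g :=
        entropyRate_prodMk_le hT hsub hg
    _ ≤ entropyRate μ T g + shannonEntropy μ fun x => f x - g x := by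
        rw [add_comm]
        gcongr
        exact entropyRate_le_shannonEntropy hsub

/-- A word of `n` letters, each a word of length `N` along the orbit, is read off from the first
`n + N` letters of the orbit, and the `N` extra letters do not matter in the limit. -/
theorem entropyRate_orbitWord_le (hT : MeasurePreserving T μ μ) (hf : Measurable f) (N : ℕ) :
    entropyRate μ T (orbitWord T f N) ≤ entropyRate μ T f := by
  have hlim : Tendsto (fun n : ℕ => shannonEntropy μ (orbitWord T f n) / n +
      shannonEntropy μ (orbitWord T f N) / n) atTop (𝓝 (entropyRate μ T f)) := by
    simpa using (tendsto_entropyRate hT hf).add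
      (tendsto_const_div_atTop_nhds_zero_nat (shannonEntropy μ (orbitWord T f N)))
  refine le_of_tendsto_of_tendsto'
    (tendsto_entropyRate hT (measurable_orbitWord hT.measurable hf N)) hlim fun n => ?_
  have hwindow : orbitWord T (orbitWord T f N) n =
      (fun w (i : Fin n) (j : Fin N) => w ⟨i + j, by omega⟩) ∘ orbitWord T f (n + N) := by
    ext x i j
    simp [orbitWord, ← Function.iterate_add_apply, add_comm]
  rw [← add_div, hwindow]
  exact div_le_div_of_nonneg_right
    ((shannonEntropy_comp_le (measurable_orbitWord hT.measurable hf _) _).trans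
      (subadditive_shannonEntropy_orbitWord hT hf n N)) n.cast_nonneg

theorem partitionEntropy_eq_entropyRate {k : ℕ} {f : X → Fin k} (hT : MeasurePreserving T μ μ)
    (hf : Measurable f) : partitionEntropy μ T f = (entropyRate μ T f : EReal) :=
  (continuous_coe_real_ereal.continuousAt.tendsto.comp (tendsto_entropyRate hT hf)).limsup_eq

end EntropyRate

section Generator

variable {X : Type*} {ι κ : Type*} {T : X → X} {f : X → ι}

/-- The events that depend on finitely many letters of the word `f x, f (T x), …`. -/
def orbitEvents (T : X → X) (f : X → ι) : Set (Set X) :=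
  {s | ∃ (n : ℕ) (B : Set (Fin n → ι)), s = orbitWord T f n ⁻¹' B}

/-- The partition into the fibres of `f` is a (one-sided) generator for `T`. -/
def IsGenerator [mX : MeasurableSpace X] (T : X → X) (f : X → ι) : Prop :=
  mX = MeasurableSpace.generateFrom (orbitEvents T f)

theorem exists_orbitWord_preimage_of_le {m n : ℕ} (h : m ≤ n) (B : Set (Fin m → ι)) :
    ∃ B' : Set (Fin n → ι), orbitWord T f m ⁻¹' B = orbitWord T f n ⁻¹' B' :=
  ⟨{w | (fun i => w (Fin.castLE h i)) ∈ B}, rfl⟩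

theorem exists_orbitWord_preimages {s t : Set X} (hs : s ∈ orbitEvents T f)
    (ht : t ∈ orbitEvents T f) :
    ∃ (n : ℕ) (B C : Set (Fin n → ι)), s = orbitWord T f n ⁻¹' B ∧ t = orbitWord T f n ⁻¹' C := by
  obtain ⟨m, B, rfl⟩ := hs
  obtain ⟨n, C, rfl⟩ := ht
  obtain ⟨B', hB⟩ := exists_orbitWord_preimage_of_le (T := T) (f := f) (le_max_left m n) B
  obtain ⟨C', hC⟩ := exists_orbitWord_preimage_of_le (T := T) (f := f) (le_max_right m n) C
  exact ⟨_, B', C', hB, hC⟩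

theorem isSetRing_orbitEvents : IsSetRing (orbitEvents T f) where
  empty_mem := ⟨0, ∅, rfl⟩
  union_mem s t hs ht := by
    obtain ⟨n, B, C, rfl, rfl⟩ := exists_orbitWord_preimages hs ht
    exact ⟨n, B ∪ C, rfl⟩
  sdiff_mem s t hs ht := by
    obtain ⟨n, B, C, rfl, rfl⟩ := exists_orbitWord_preimages hs ht
    exact ⟨n, B \ C, rfl⟩

theorem exists_comp_ne_subset_iUnion_symmDiff {Y : Type*} [Nonempty κ] (π : X → Y) (P : X → κ)
    (B : κ → Set Y) :
    ∃ g : Y → κ, {x | P x ≠ g (π x)} ⊆ ⋃ a, symmDiff (π ⁻¹' B a) (P ⁻¹' {a}) := by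
  classical
  refine ⟨fun y => if h : ∃ a, y ∈ B a then h.choose else Classical.arbitrary κ, fun x hx => ?_⟩
  by_contra hnot
  have hiff : ∀ a, π x ∈ B a ↔ P x = a := fun a => by
    have := not_exists.1 (mt Set.mem_iUnion.2 hnot) a
    simp only [Set.mem_symmDiff, Set.mem_preimage, Set.mem_singleton_iff] at this
    tauto
  have hex : ∃ a, π x ∈ B a := ⟨P x, (hiff _).2 rfl⟩
  refine hx ?_
  exact ((hiff _).1 hex.choose_spec).trans (dif_pos hex).symm

variable [MeasurableSpace X] {μ : Measure X}

theorem IsGenerator.exists_measureReal_symmDiff_lt [IsFiniteMeasure μ] (h : IsGenerator T f)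
    {A : Set X} (hA : MeasurableSet A) {ε : ℝ} (hε : 0 < ε) :
    ∃ M, ∀ N ≥ M, ∃ B : Set (Fin N → ι), μ.real (symmDiff (orbitWord T f N ⁻¹' B) A) < ε := by
  obtain ⟨t, ⟨M, B, rfl⟩, hlt⟩ := exists_measure_symmDiff_lt_of_generateFrom_isSetRing (μ := μ)
    isSetRing_orbitEvents
    ⟨{Set.univ}, Set.countable_singleton _, Set.singleton_subset_iff.2 ⟨0, Set.univ, rfl⟩, by simp⟩
    h hA (ENNReal.ofReal_pos.2 hε)
  refine ⟨M, fun N hN => ?_⟩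
  obtain ⟨B', hB'⟩ := exists_orbitWord_preimage_of_le (T := T) (f := f) hN B
  rw [hB'] at hlt
  exact ⟨B', (ENNReal.lt_ofReal_iff_toReal_lt (measure_ne_top _ _)).1 hlt⟩

theorem IsGenerator.exists_measureReal_ne_lt [IsFiniteMeasure μ] [Finite κ] [Nonempty κ]
    [MeasurableSpace κ] [MeasurableSingletonClass κ] (h : IsGenerator T f) {P : X → κ}
    (hP : Measurable P) {ε : ℝ} (hε : 0 < ε) :
    ∃ (N : ℕ) (g : (Fin N → ι) → κ), μ.real {x | P x ≠ g (orbitWord T f N x)} < ε := by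
  have := Fintype.ofFinite κ
  choose M hM using fun a => h.exists_measureReal_symmDiff_lt (μ := μ)
    (hP (measurableSet_singleton a)) (div_pos hε (Nat.cast_pos.2 (Fintype.card_pos (α := κ))))
  choose B hB using fun a => hM a (Finset.univ.sup M) (Finset.le_sup (Finset.mem_univ a))
  obtain ⟨g, hg⟩ := exists_comp_ne_subset_iUnion_symmDiff (orbitWord T f _) P B
  refine ⟨_, g, ?_⟩
  calc μ.real {x | P x ≠ g (orbitWord T f _ x)}
      ≤ ∑ a, μ.real (symmDiff (orbitWord T f _ ⁻¹' B a) (P ⁻¹' {a})) :=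
        (measureReal_mono hg).trans (measureReal_iUnion_fintype_le _)
    _ < ∑ _a : κ, ε / Fintype.card κ :=
        Finset.sum_lt_sum_of_nonempty Finset.univ_nonempty fun a _ => hB a
    _ = ε := by
        rw [Finset.sum_const, Finset.card_univ, nsmul_eq_mul, mul_div_cancel₀ _ (by simp)]

variable [IsProbabilityMeasure μ] [Fintype ι] [MeasurableSpace ι] [MeasurableSingletonClass ι]

theorem IsGenerator.entropyRate_le [Fintype κ] [MeasurableSpace κ] [MeasurableSingletonClass κ]
    [AddGroup κ] (h : IsGenerator T f) (hT : MeasurePreserving T μ μ) (hf : Measurable f)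
    {P : X → κ} (hP : Measurable P) : entropyRate μ T P ≤ entropyRate μ T f := by
  choose N g hg using fun j : ℕ => h.exists_measureReal_ne_lt (μ := μ) hP
    (Nat.one_div_pos_of_nat (α := ℝ) (n := j))
  have hword := fun j => measurable_orbitWord hT.measurable hf (N j)
  have happrox := fun j => (measurable_of_finite (g j)).comp (hword j)
  have hdefect : ∀ j, Measurable fun x => P x - g j (orbitWord T f (N j) x) := fun j =>
    (measurable_of_finite fun c : κ × κ => c.1 - c.2).comp (hP.prodMk (happrox j))
  have hlim : Tendsto (fun j => shannonEntropy μ fun x => P x - g j (orbitWord T f (N j) x)) atTop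
      (𝓝 0) := by
    refine tendsto_shannonEntropy_zero hdefect 0 (squeeze_zero (fun _ => measureReal_nonneg)
      (fun j => ?_) tendsto_one_div_add_atTop_nhds_zero_nat)
    simpa only [ne_eq, sub_eq_zero] using (hg j).le
  refine ge_of_tendsto' (by simpa using hlim.const_add (entropyRate μ T f)) fun j => ?_
  calc entropyRate μ T P
      ≤ entropyRate μ T (g j ∘ orbitWord T f (N j)) +
          shannonEntropy μ fun x => P x - g j (orbitWord T f (N j) x) :=
        entropyRate_le_add_sub hT hP (happrox j)
    _ ≤ entropyRate μ T f + shannonEntropy μ fun x => P x - g j (orbitWord T f (N j) x) := by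
        gcongr
        exact (entropyRate_comp_le hT (hword j)).trans (entropyRate_orbitWord_le hT hf (N j))

theorem IsGenerator.ksEntropy_eq (h : IsGenerator T f) (hT : MeasurePreserving T μ μ)
    (hf : Measurable f) : ksEntropy μ T = (entropyRate μ T f : EReal) := by
  refine le_antisymm (iSup_le fun k => iSup₂_le fun P hP => ?_) ?_
  · obtain ⟨x⟩ := μ.nonempty_of_neZero
    have : NeZero k := ⟨(P x).pos.ne'⟩
    rw [partitionEntropy_eq_entropyRate hT hP, EReal.coe_le_coe_iff]
    exact h.entropyRate_le hT hf hP
  · let e := Fintype.equivFin ι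
    have he : Measurable (e ∘ f) := (measurable_of_finite e).comp hf
    calc (entropyRate μ T f : EReal) ≤ (entropyRate μ T (e ∘ f) : EReal) := by
          rw [EReal.coe_le_coe_iff]
          simpa [Function.comp_def] using entropyRate_comp_le hT he (φ := e.symm)
      _ = partitionEntropy μ T (e ∘ f) := (partitionEntropy_eq_entropyRate hT he).symm
      _ ≤ ksEntropy μ T := le_iSup_of_le _ (le_iSup₂_of_le (e ∘ f) he le_rfl)

end Generator

/-! ### The shift and its cylinder events -/

section Shift

theorem measurable_shift : Measurable shift :=
  measurable_pi_lambda _ fun i => measurable_pi_apply (i + 1)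

theorem shift_iterate_apply (n : ℕ) (x : Shift) (i : ℕ) : shift^[n] x i = x (i + n) := by
  induction n generalizing x with
  | zero => rfl
  | succ n ih => rw [Function.iterate_succ_apply, ih, shift, add_assoc, add_comm n 1]

theorem orbitWord_shift : orbitWord shift (fun x => x 0) = pre := by
  ext n x i
  simp [pre, orbitWord, shift_iterate_apply]

theorem isGenerator_shift : IsGenerator shift fun x : Shift => x 0 := by
  refine le_antisymm (iSup_le fun i => ?_) (MeasurableSpace.generateFrom_le ?_)
  · rintro _ ⟨s, -, rfl⟩
    refine MeasurableSpace.measurableSet_generateFrom ⟨i + 1, {w | w (Fin.last i) ∈ s}, ?_⟩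
    rw [orbitWord_shift]
    rfl
  · rintro _ ⟨n, B, rfl⟩
    rw [orbitWord_shift]
    exact measurable_pre n B.toFinite.measurableSet

theorem ext_of_measureReal_pre {μ ν : Measure Shift} [IsProbabilityMeasure μ]
    [IsProbabilityMeasure ν]
    (h : ∀ n (w : Fin n → ℤˣ), μ.real (pre n ⁻¹' {w}) = ν.real (pre n ⁻¹' {w})) : μ = ν := by
  refine ext_of_generate_finite _ isGenerator_shift isSetRing_orbitEvents.isSetSemiring.isPiSystem
    ?_ (by simp)
  rintro _ ⟨n, B, rfl⟩
  have hmap : μ.map (pre n) = ν.map (pre n) := by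
    refine Measure.ext_of_singleton fun w => ?_
    rw [Measure.map_apply (measurable_pre n) (measurableSet_singleton w),
      Measure.map_apply (measurable_pre n) (measurableSet_singleton w),
      ← measureReal_eq_measureReal_iff, h]
  rw [orbitWord_shift, ← Measure.map_apply (measurable_pre n) B.toFinite.measurableSet, hmap,
    Measure.map_apply (measurable_pre n) B.toFinite.measurableSet]

theorem exists_pre_preimage_singleton_subset {u : Set Shift} (hu : IsOpen u) {x : Shift}
    (hx : x ∈ u) : ∃ n, pre n ⁻¹' {pre n x} ⊆ u := by
  obtain ⟨I, v, hv, hsub⟩ := isOpen_pi_iff.1 hu x hx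
  refine ⟨I.sup id + 1, fun y hy => hsub fun i hi => ?_⟩
  have heq : y i = x i :=
    congrFun hy ⟨i, Nat.lt_succ_of_le (Finset.le_sup (f := id) (Finset.mem_coe.1 hi))⟩
  exact heq ▸ (hv i hi).2

theorem tendsto_of_tendsto_pre {J : Type*} {l : Filter J} [l.IsCountablyGenerated]
    {μ : J → ProbabilityMeasure Shift} {ν : ProbabilityMeasure Shift}
    (h : ∀ n (B : Set (Fin n → ℤˣ)), Tendsto (fun j => (μ j : Measure Shift).real (pre n ⁻¹' B)) l
      (𝓝 ((ν : Measure Shift).real (pre n ⁻¹' B)))) :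
    Tendsto μ l (𝓝 ν) := by
  have hpi := isSetRing_orbitEvents (T := shift) (f := fun x => x 0)
    |>.isSetSemiring.isPiSystem
  refine hpi.tendsto_probabilityMeasure_of_tendsto_of_mem ?_ (fun u hu x hx => ?_) ?_
  · rintro _ ⟨n, B, rfl⟩
    rw [orbitWord_shift]
    exact measurable_pre n B.toFinite.measurableSet
  · obtain ⟨n, hn⟩ := exists_pre_preimage_singleton_subset hu hx
    have hcont : Continuous (pre n) := continuous_pi fun i => continuous_apply (i : ℕ)
    exact ⟨_, ⟨n, {pre n x}, by rw [orbitWord_shift]⟩,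
      ((isOpen_discrete {pre n x}).preimage hcont).mem_nhds rfl, hn⟩
  · rintro _ ⟨n, B, rfl⟩
    rw [orbitWord_shift]
    exact NNReal.tendsto_coe.1 (h n B)

end Shift

/-! ### Bernoulli measures as equilibrium states -/

section Bernoulli

/-- The total spin `S_n = w₀ + ⋯ + w_{n-1}` of a word. -/
noncomputable def totalSpin {n : ℕ} (w : Fin n → ℤˣ) : ℝ := ∑ i, ((w i : ℤ) : ℝ)

theorem spinLaw_real_singleton (b : ℝ) (u : ℤˣ) :
    (spinLaw b).real {u} = Real.exp (b * ((u : ℤ) : ℝ)) / (2 * Real.cosh b) := by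
  have hpos : ∀ c : ℝ, 0 ≤ Real.exp c / (Real.exp b + Real.exp (-b)) := fun c => by positivity
  rw [Real.cosh_eq, mul_div_cancel₀ _ two_ne_zero]
  rcases Int.units_eq_one_or u with rfl | rfl <;>
    simp [measureReal_def, spinLaw, Set.indicator, ENNReal.toReal_ofReal (hpos _)]

theorem spinLaw_zero : spinLaw 0 = rho := by
  refine Measure.ext_of_singleton fun u => ?_
  rw [rho_singleton, ← ofReal_measureReal, spinLaw_real_singleton]
  simp [ENNReal.ofReal_inv_of_pos]

theorem bernoulli_zero : bernoulli 0 = unif :=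
  Subtype.ext (by simp only [bernoulli, unif, spinLaw_zero])

theorem bernoulli_real_pre (b : ℝ) (n : ℕ) (w : Fin n → ℤˣ) :
    (bernoulli b : Measure Shift).real (pre n ⁻¹' {w}) =
      Real.exp (b * totalSpin w) / (2 * Real.cosh b) ^ n := by
  have hlaw : (bernoulli b : Measure Shift).map (pre n) = Measure.infinitePi fun _ => spinLaw b :=
    Measure.map_infinitePi_infinitePi_of_inj Fin.val_injective
  rw [← map_measureReal_apply (measurable_pre n) (measurableSet_singleton w), hlaw,
    measureReal_def, Measure.infinitePi_singleton_of_fintype, ENNReal.toReal_prod]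
  simp_rw [← measureReal_def, spinLaw_real_singleton]
  rw [Finset.prod_div_distrib, ← Real.exp_sum, ← Finset.mul_sum, totalSpin, Finset.prod_const,
    Finset.card_univ, Fintype.card_fin]

theorem bernoulli_real_pre_pos (b : ℝ) {n : ℕ} (w : Fin n → ℤˣ) :
    0 < (bernoulli b : Measure Shift).real (pre n ⁻¹' {w}) := by
  rw [bernoulli_real_pre]
  positivity

theorem isShiftInvariant_bernoulli (b : ℝ) : IsShiftInvariant (bernoulli b) :=
  ⟨measurable_shift, Measure.map_infinitePi_infinitePi_of_inj (P := fun _ => spinLaw b)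
    Nat.succ_injective⟩

theorem psi_apply (x : Shift) : psi x = ((x 0 : ℤ) : ℝ) := by
  rcases Int.units_eq_one_or (x 0) with h | h <;>
    simp [psi, cyl, Set.indicator, h]

theorem totalSpin_pre (n : ℕ) (x : Shift) :
    totalSpin (pre n x) = ∑ i ∈ Finset.range n, psi (shift^[i] x) := by
  simp [totalSpin, pre, psi_apply, shift_iterate_apply, Finset.sum_range]

variable {ν : Measure Shift} [IsProbabilityMeasure ν]

theorem integral_totalSpin_pre (hν : MeasurePreserving shift ν ν) (n : ℕ) :
    ∫ x, totalSpin (pre n x) ∂ν = n * ∫ x, psi x ∂ν := by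
  have hpsi : Integrable psi ν := psi.continuous.integrable_of_hasCompactSupport
    (HasCompactSupport.of_compactSpace _)
  have hiter : ∀ i, ∫ x, psi (shift^[i] x) ∂ν = ∫ x, psi x ∂ν := fun i => by
    conv_rhs => rw [← (hν.iterate i).map_eq]
    rw [integral_map (hν.iterate i).measurable.aemeasurable psi.continuous.aestronglyMeasurable]
  have hint : ∀ i, Integrable (fun x => psi (shift^[i] x)) ν := fun i =>
    (hν.iterate i).integrable_comp_of_integrable hpsi
  simp_rw [totalSpin_pre]
  rw [integral_finsetSum _ fun i _ => hint i]
  simp [hiter]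

theorem shannonEntropy_pre_add_relEntropy (hν : MeasurePreserving shift ν ν) (b : ℝ) (n : ℕ) :
    shannonEntropy ν (pre n) +
        relEntropy (fun w : Fin n → ℤˣ => ν.real (pre n ⁻¹' {w}))
          (fun w => (bernoulli b : Measure Shift).real (pre n ⁻¹' {w})) =
      n * (Real.log (2 * Real.cosh b) - b * ∫ x, psi x ∂ν) := by
  have hpos := bernoulli_real_pre_pos b (n := n)
  have hlog : ∀ w : Fin n → ℤˣ, Real.log ((bernoulli b : Measure Shift).real (pre n ⁻¹' {w})) =
      b * totalSpin w - n * Real.log (2 * Real.cosh b) := fun w => by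
    rw [bernoulli_real_pre, Real.log_div (Real.exp_ne_zero _) (by positivity), Real.log_exp,
      Real.log_pow]
  calc _ = -∑ w : Fin n → ℤˣ, ν.real (pre n ⁻¹' {w}) *
          Real.log ((bernoulli b : Measure Shift).real (pre n ⁻¹' {w})) :=
        sum_negMulLog_add_relEntropy
          (by rw [sum_measureReal_preimage (measurable_pre n),
            sum_measureReal_preimage (measurable_pre n)])
          fun w hw => absurd hw (hpos w).ne'
    _ = -(b * (n * ∫ x, psi x ∂ν) - n * Real.log (2 * Real.cosh b)) := by
        simp_rw [hlog, mul_sub, Finset.sum_sub_distrib, mul_left_comm _ b, ← Finset.mul_sum,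
          ← Finset.sum_mul]
        rw [← integral_comp_eq_sum (measurable_pre n) totalSpin, integral_totalSpin_pre hν,
          sum_measureReal_preimage (measurable_pre n), one_mul]
    _ = _ := by ring

theorem mul_entropyRate_shift_le (n : ℕ) :
    n * entropyRate ν shift (fun x => x 0) ≤ shannonEntropy ν (pre n) := by
  simpa only [orbitWord_shift] using mul_entropyRate_le (μ := ν) (T := shift) (fun x => x 0) n

theorem entropyRate_add_le (hν : MeasurePreserving shift ν ν) (b : ℝ) :
    entropyRate ν shift (fun x => x 0) + b * ∫ x, psi x ∂ν ≤ Real.log (2 * Real.cosh b) := by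
  have hrate := mul_entropyRate_shift_le (ν := ν) 1
  have hid := shannonEntropy_pre_add_relEntropy hν b 1
  have hrel := relEntropy_nonneg (p := fun w : Fin 1 → ℤˣ => ν.real (pre 1 ⁻¹' {w}))
    (q := fun w => (bernoulli b : Measure Shift).real (pre 1 ⁻¹' {w}))
    (fun _ => measureReal_nonneg) fun _ => measureReal_nonneg
  simp only [Nat.cast_one, one_mul] at hrate hid
  linarith

theorem entropyRate_bernoulli_add (b : ℝ) :
    entropyRate (bernoulli b : Measure Shift) shift (fun x => x 0) +
      b * ∫ x, psi x ∂(bernoulli b : Measure Shift) = Real.log (2 * Real.cosh b) := by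
  have hself : ∀ (n : ℕ) (q : (Fin n → ℤˣ) → ℝ), (∀ w, 0 < q w) → relEntropy q q = 0 :=
    fun n q hq => (relEntropy_eq_zero_iff (fun w => (hq w).le) hq).2 rfl
  have hlim := tendsto_entropyRate (isShiftInvariant_bernoulli b) (measurable_pi_apply 0)
  rw [orbitWord_shift] at hlim
  rw [← eq_sub_iff_add_eq]
  refine tendsto_nhds_unique hlim (tendsto_const_nhds.congr' ?_)
  filter_upwards [eventually_ne_atTop 0] with n hn
  have hid := shannonEntropy_pre_add_relEntropy (isShiftInvariant_bernoulli b) b n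
  rw [hself n _ (bernoulli_real_pre_pos b), add_zero] at hid
  rw [hid, mul_div_cancel_left₀ _ (Nat.cast_ne_zero.2 hn)]

theorem eq_bernoulli_of_le_entropyRate_add (hν : MeasurePreserving shift ν ν) {b : ℝ}
    (h : Real.log (2 * Real.cosh b) ≤
      entropyRate ν shift (fun x => x 0) + b * ∫ x, psi x ∂ν) :
    ν = bernoulli b := by
  refine ext_of_measureReal_pre fun n => congrFun ?_
  have hpos := bernoulli_real_pre_pos b (n := n)
  have hnonneg : ∀ w : Fin n → ℤˣ, 0 ≤ ν.real (pre n ⁻¹' {w}) := fun _ => measureReal_nonneg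
  refine (relEntropy_eq_zero_iff hnonneg hpos).1
    (le_antisymm ?_ (relEntropy_nonneg hnonneg fun w => (hpos w).le))
  have hrate := mul_entropyRate_shift_le (ν := ν) n
  have hid := shannonEntropy_pre_add_relEntropy hν b n
  have hmul := mul_le_mul_of_nonneg_left (sub_le_iff_le_add.2 h) (Nat.cast_nonneg n : (0 : ℝ) ≤ n)
  linarith

theorem freeEnergy_smul_psi (b : ℝ) {μ : ProbabilityMeasure Shift} (hμ : IsShiftInvariant μ) :
    freeEnergy (b • psi) μ = ((entropyRate (μ : Measure Shift) shift (fun x => x 0) +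
      b * ∫ x, psi x ∂(μ : Measure Shift) : ℝ) : EReal) := by
  simp only [freeEnergy, isGenerator_shift.ksEntropy_eq hμ (measurable_pi_apply 0),
    ContinuousMap.coe_smul, Pi.smul_apply, smul_eq_mul, integral_const_mul, EReal.coe_add]

theorem freeEnergy_bernoulli (b : ℝ) :
    freeEnergy (b • psi) (bernoulli b) = (Real.log (2 * Real.cosh b) : EReal) := by
  rw [freeEnergy_smul_psi b (isShiftInvariant_bernoulli b), entropyRate_bernoulli_add]

theorem pressure_smul_psi (b : ℝ) :
    pressure (b • psi) = (Real.log (2 * Real.cosh b) : EReal) := by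
  refine le_antisymm (iSup₂_le fun μ hμ => ?_) ?_
  · rw [freeEnergy_smul_psi b hμ, EReal.coe_le_coe_iff]
    exact entropyRate_add_le hμ b
  · rw [← freeEnergy_bernoulli]
    exact le_iSup₂_of_le (bernoulli b) (isShiftInvariant_bernoulli b) le_rfl

theorem isDynamicalGibbsMeasure_bernoulli (b : ℝ) :
    IsDynamicalGibbsMeasure (b • psi) (bernoulli b) := by
  refine ⟨⟨isShiftInvariant_bernoulli b, ?_⟩, fun ν ⟨hν, heq⟩ => ?_⟩
  · rw [freeEnergy_bernoulli, pressure_smul_psi]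
  · rw [pressure_smul_psi, freeEnergy_smul_psi b hν, EReal.coe_eq_coe_iff] at heq
    exact Subtype.ext (eq_bernoulli_of_le_entropyRate_add hν heq.ge)

end Bernoulli

/-! ### The maximum of `phiI` -/

section RateFunction

theorem hasDerivAt_tanh (x : ℝ) : HasDerivAt Real.tanh (1 / Real.cosh x ^ 2) x := by
  have h := (Real.hasDerivAt_sinh x).div (Real.hasDerivAt_cosh x) (Real.cosh_pos x).ne'
  rw [show Real.tanh = Real.sinh / Real.cosh from funext Real.tanh_eq_sinh_div_cosh]
  rwa [← sq, ← sq, Real.cosh_sq_sub_sinh_sq] at h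

theorem strictConcaveOn_tanh : StrictConcaveOn ℝ (Set.Ici 0) Real.tanh := by
  refine StrictAntiOn.strictConcaveOn_of_deriv (convex_Ici 0)
    (continuous_iff_continuousAt.2 fun x => (hasDerivAt_tanh x).continuousAt).continuousOn ?_
  intro x hx y hy hxy
  rw [interior_Ici, Set.mem_Ioi] at hx hy
  rw [(hasDerivAt_tanh x).deriv, (hasDerivAt_tanh y).deriv]
  have hcosh : Real.cosh x < Real.cosh y :=
    Real.cosh_lt_cosh.2 (by rwa [abs_of_pos hx, abs_of_pos hy])
  have := Real.cosh_pos x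
  gcongr

theorem strictAntiOn_tanh_div : StrictAntiOn (fun x => Real.tanh x / x) (Set.Ioi 0) := by
  intro x hx y hy hxy
  have h := strictConcaveOn_tanh.secant_strict_mono Set.self_mem_Ici (Set.mem_Ioi.1 hx).le
    (Set.mem_Ioi.1 hy).le (Set.mem_Ioi.1 hx).ne' (Set.mem_Ioi.1 hy).ne' hxy
  simpa using h

theorem hasDerivAt_phiI (β x : ℝ) :
    HasDerivAt (phiI β) (β * (Real.tanh (β * x) - x)) x := by
  have hlin : HasDerivAt (fun x => β * x) β x := by simpa using (hasDerivAt_id x).const_mul β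
  refine ((hlin.cosh.log (Real.cosh_pos _).ne').sub
    (((hasDerivAt_id x).pow 2).const_mul (β / 2))).congr_deriv ?_
  rw [Real.tanh_eq_sinh_div_cosh]
  simp
  ring

theorem continuous_phiI (β : ℝ) : Continuous (phiI β) :=
  continuous_iff_continuousAt.2 fun x => (hasDerivAt_phiI β x).continuousAt

theorem phiI_neg (β x : ℝ) : phiI β (-x) = phiI β x := by
  simp [phiI]

theorem phiI_abs (β x : ℝ) : phiI β |x| = phiI β x := by
  simp [phiI, ← Real.cosh_abs (β * x), ← Real.cosh_abs (β * |x|), abs_mul]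

variable {β : ℝ}

theorem strictConcaveOn_phiI_sqrt (hβ : 0 < β) :
    StrictConcaveOn ℝ (Set.Ici 0) fun u => phiI β √u := by
  have hderiv : ∀ u ∈ Set.Ioi (0 : ℝ), deriv (fun u => phiI β √u) u =
      β / 2 * (β * (Real.tanh (β * √u) / (β * √u)) - 1) := fun u hu => by
    have hsqrt := Real.sqrt_ne_zero'.2 hu
    refine ((hasDerivAt_phiI β √u).comp u
      (Real.hasDerivAt_sqrt (Set.mem_Ioi.1 hu).ne')).deriv.trans ?_
    field_simp
  refine StrictAntiOn.strictConcaveOn_of_deriv (convex_Ici 0)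
    ((continuous_phiI β).comp Real.continuous_sqrt).continuousOn ?_
  rw [interior_Ici]
  intro u hu v hv huv
  have hsqrt : √u < √v := Real.sqrt_lt_sqrt (Set.mem_Ioi.1 hu).le huv
  have hdiv : Real.tanh (β * √v) / (β * √v) < Real.tanh (β * √u) / (β * √u) :=
    strictAntiOn_tanh_div (mul_pos hβ (Real.sqrt_pos.2 hu)) (mul_pos hβ (Real.sqrt_pos.2 hv))
      (mul_lt_mul_of_pos_left hsqrt hβ)
  rw [hderiv u hu, hderiv v hv]
  gcongr

theorem antitoneOn_phiI (hβ : 0 < β) : AntitoneOn (phiI β) (Set.Ici 1) := by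
  refine antitoneOn_of_deriv_nonpos (convex_Ici 1) (continuous_phiI β).continuousOn
    (fun x _ => (hasDerivAt_phiI β x).differentiableAt.differentiableWithinAt) fun x hx => ?_
  rw [interior_Ici, Set.mem_Ioi] at hx
  rw [(hasDerivAt_phiI β x).deriv]
  exact mul_nonpos_of_nonneg_of_nonpos hβ.le
    (sub_nonpos.2 ((Real.tanh_lt_one _).le.trans hx.le))

theorem exists_isMaxOn_phiI (β : ℝ) :
    ∃ ξ ∈ Set.Icc (0 : ℝ) 1, IsMaxOn (phiI β) (Set.Icc 0 1) ξ :=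
  isCompact_Icc.exists_isMaxOn (Set.nonempty_Icc.2 zero_le_one) (continuous_phiI β).continuousOn

theorem phiI_le_of_isMaxOn (hβ : 0 < β) {ξ : ℝ} (hmax : IsMaxOn (phiI β) (Set.Icc 0 1) ξ)
    (x : ℝ) : phiI β x ≤ phiI β ξ := by
  rw [← phiI_abs]
  rcases le_total |x| 1 with h | h
  · exact hmax ⟨abs_nonneg x, h⟩
  · exact (antitoneOn_phiI hβ Set.self_mem_Ici h h).trans (hmax (Set.right_mem_Icc.2 zero_le_one))

theorem abs_eq_of_phiI_eq (hβ : 0 < β) {ξ : ℝ} (hξ : 0 ≤ ξ)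
    (hmax : IsMaxOn (phiI β) (Set.Icc 0 1) ξ) {x : ℝ} (hx : phiI β x = phiI β ξ) : |x| = ξ := by
  have hmaxSq : ∀ y, phiI β y = phiI β ξ →
      IsMaxOn (fun u => phiI β √u) (Set.Ici 0) (y ^ 2) := fun y hy u _ => by
    change phiI β √u ≤ phiI β √(y ^ 2)
    rw [Real.sqrt_sq_eq_abs, phiI_abs, hy]
    exact phiI_le_of_isMaxOn hβ hmax _
  have hsq : x ^ 2 = ξ ^ 2 := (strictConcaveOn_phiI_sqrt hβ).eq_of_isMaxOn (hmaxSq x hx)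
    (hmaxSq ξ rfl) (sq_nonneg x) (sq_nonneg ξ)
  rwa [sq_eq_sq_iff_abs_eq_abs, abs_of_nonneg hξ] at hsq

theorem eq_of_isMaxOn_phiI (hβ : 0 < β) {y z : ℝ} (hy : y ∈ Set.Icc (0 : ℝ) 1)
    (hz : z ∈ Set.Icc (0 : ℝ) 1) (hymax : IsMaxOn (phiI β) (Set.Icc 0 1) y)
    (hzmax : IsMaxOn (phiI β) (Set.Icc 0 1) z) : y = z := by
  rw [← abs_of_nonneg hy.1]
  exact abs_eq_of_phiI_eq hβ hz.1 hzmax (le_antisymm (hzmax hy) (hymax hz))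

theorem isMaxOn_phiI_zero (hβ : 0 < β) (hβ1 : β ≤ 1) : IsMaxOn (phiI β) (Set.Icc 0 1) 0 := by
  intro x _
  have hlog : Real.log (Real.cosh (β * x)) ≤ (β * x) ^ 2 / 2 := by
    rw [Real.log_le_iff_le_exp (Real.cosh_pos _)]
    exact Real.cosh_le_exp_half_sq _
  have hnonneg : 0 ≤ β * (1 - β) * x ^ 2 :=
    mul_nonneg (mul_nonneg hβ.le (sub_nonneg.2 hβ1)) (sq_nonneg x)
  change phiI β x ≤ phiI β 0
  simp only [phiI, mul_zero, Real.cosh_zero, Real.log_one]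
  linarith

theorem phiI_le (hβ : 0 < β) (x : ℝ) : phiI β x ≤ β - β / 4 * x ^ 2 := by
  have hcosh : Real.cosh (β * x) ≤ Real.exp |β * x| := by
    rw [← Real.cosh_abs, Real.cosh_eq]
    linarith [Real.exp_le_exp.2 (neg_le_self (abs_nonneg (β * x)))]
  have hlog : Real.log (Real.cosh (β * x)) ≤ β * |x| := by
    rwa [Real.log_le_iff_le_exp (Real.cosh_pos _), ← abs_of_pos hβ, ← abs_mul, abs_of_pos hβ]
  have hsquare : 0 ≤ β * (|x| / 2 - 1) ^ 2 := by positivity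
  rw [phiI, ← sq_abs x]
  linarith

theorem integrable_exp_phiI (hβ : 0 < β) : Integrable fun x => Real.exp (phiI β x) := by
  refine ((integrable_exp_neg_mul_sq (show 0 < β / 4 by positivity)).const_mul
    (Real.exp β)).mono' (Real.continuous_exp.comp (continuous_phiI β)).aestronglyMeasurable
    (Eventually.of_forall fun x => ?_)
  rw [Real.norm_of_nonneg (Real.exp_pos _).le, ← Real.exp_add, Real.exp_le_exp]
  linarith [phiI_le hβ x]

theorem tendsto_phiI_cocompact (hβ : 0 < β) : Tendsto (phiI β) (cocompact ℝ) atBot := by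
  have hsq : Tendsto (fun x : ℝ => β / 4 * ‖x‖ ^ 2) (cocompact ℝ) atTop :=
    ((tendsto_pow_atTop two_ne_zero).comp tendsto_norm_cocompact_atTop).const_mul_atTop
      (by positivity)
  refine tendsto_atBot_mono (fun x => ?_)
    (tendsto_atBot_add_const_left _ β (tendsto_neg_atTop_atBot.comp hsq))
  simpa [sub_eq_add_neg] using phiI_le hβ x

theorem isProperMap_phiI (hβ : 0 < β) : IsProperMap (phiI β) :=
  isProperMap_iff_tendsto_cocompact.2
    ⟨continuous_phiI β, (tendsto_phiI_cocompact hβ).mono_right atBot_le_cocompact⟩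

end RateFunction

/-! ### Laplace's method -/

section Laplace

variable {X : Type*} [MeasurableSpace X] {μ : Measure X} {f : X → ℝ} {M : ℝ}

theorem exp_nat_mul_le {n : ℕ} (hn : n ≠ 0) {t r : ℝ} (h : t ≤ r) :
    Real.exp (n * t) ≤ Real.exp (n * r) * Real.exp (-r) * Real.exp t := by
  have hn1 : (1 : ℝ) ≤ n := Nat.one_le_cast.2 (Nat.one_le_iff_ne_zero.2 hn)
  rw [← Real.exp_add, ← Real.exp_add, Real.exp_le_exp]
  nlinarith

theorem integrable_exp_nat_mul (hf : Measurable f) (hM : ∀ x, f x ≤ M)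
    (hint : Integrable (fun x => Real.exp (f x)) μ) {n : ℕ} (hn : n ≠ 0) :
    Integrable (fun x => Real.exp (n * f x)) μ := by
  refine (hint.const_mul (Real.exp (n * M) * Real.exp (-M))).mono' (by fun_prop)
    (Eventually.of_forall fun x => ?_)
  rw [Real.norm_of_nonneg (Real.exp_pos _).le]
  exact exp_nat_mul_le hn (hM x)

theorem tendsto_exp_div_integral_exp (hf : Measurable f) (hM : ∀ x, f x ≤ M)
    (hint : Integrable (fun x => Real.exp (f x)) μ) (hsup : ∀ r < M, 0 < μ {x | r < f x})
    {r : ℝ} (hr : r < M) :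
    Tendsto (fun n : ℕ => Real.exp (n * r) / ∫ x, Real.exp (n * f x) ∂μ) atTop (𝓝 0) := by
  obtain ⟨r', hrr', hr'M⟩ := exists_between hr
  have hfin : μ {x | r' < f x} < ∞ := by
    simpa using hint.measure_gt_lt_top (Real.exp_pos r')
  have hvol : 0 < μ.real {x | r' < f x} := ENNReal.toReal_pos (hsup r' hr'M).ne' hfin.ne
  have hmarkov : ∀ n : ℕ, n ≠ 0 →
      Real.exp (n * r') * μ.real {x | r' < f x} ≤ ∫ x, Real.exp (n * f x) ∂μ := fun n hn => by
    have hsubset : {x | r' < f x} ⊆ {x | Real.exp (n * r') ≤ Real.exp (n * f x)} :=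
      fun x hx => Real.exp_le_exp.2 (mul_le_mul_of_nonneg_left hx.le (Nat.cast_nonneg n))
    have hintn := integrable_exp_nat_mul hf hM hint hn
    have hfinn := (hintn.measure_ge_lt_top (Real.exp_pos (n * r'))).ne
    exact (mul_le_mul_of_nonneg_left (measureReal_mono hsubset hfinn) (Real.exp_pos _).le).trans
      (mul_meas_ge_le_integral_of_nonneg (Eventually.of_forall fun x => (Real.exp_pos _).le)
        hintn _)
  have hgeom : Tendsto (fun n : ℕ => Real.exp (r - r') ^ n / μ.real {x | r' < f x})
      atTop (𝓝 0) := by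
    simpa using (tendsto_pow_atTop_nhds_zero_of_lt_one (Real.exp_pos _).le
      (Real.exp_lt_one_iff.2 (sub_neg.2 hrr'))).div_const (μ.real {x | r' < f x})
  refine squeeze_zero' (Eventually.of_forall fun n =>
    div_nonneg (Real.exp_pos _).le (integral_nonneg fun x => (Real.exp_pos _).le)) ?_ hgeom
  filter_upwards [eventually_ne_atTop 0] with n hn
  calc Real.exp (n * r) / ∫ x, Real.exp (n * f x) ∂μ
      ≤ Real.exp (n * r) / (Real.exp (n * r') * μ.real {x | r' < f x}) := by
        gcongr
        exact hmarkov n hn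
    _ = Real.exp (r - r') ^ n / μ.real {x | r' < f x} := by
        rw [← div_div, ← Real.exp_sub, ← Real.exp_nat_mul, mul_sub]

theorem integral_exp_nat_mul_pos [NeZero μ] (hf : Measurable f) (hM : ∀ x, f x ≤ M)
    (hint : Integrable (fun x => Real.exp (f x)) μ) {n : ℕ} (hn : n ≠ 0) :
    0 < ∫ x, Real.exp (n * f x) ∂μ :=
  integral_exp_pos (integrable_exp_nat_mul hf hM hint hn)

theorem abs_integral_exp_mul_le (hf : Measurable f) (hM : ∀ x, f x ≤ M)
    (hint : Integrable (fun x => Real.exp (f x)) μ) {G : X → ℝ}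
    {ε r K : ℝ} (hε : 0 ≤ ε) (hnear : ∀ x, r < f x → |G x| ≤ ε)
    (hK : ∀ x, |G x| ≤ K) {n : ℕ} (hn : n ≠ 0) :
    |∫ x, Real.exp (n * f x) * G x ∂μ| ≤ ε * ∫ x, Real.exp (n * f x) ∂μ +
      K * (Real.exp (n * r) * Real.exp (-r) * ∫ x, Real.exp (f x) ∂μ) := by
  have hintn := integrable_exp_nat_mul hf hM hint hn
  have hbound : ∀ x, ‖Real.exp (n * f x) * G x‖ ≤ ε * Real.exp (n * f x) +
      K * (Real.exp (n * r) * Real.exp (-r) * Real.exp (f x)) := fun x => by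
    have hK0 : 0 ≤ K := (abs_nonneg _).trans (hK x)
    rw [norm_mul, Real.norm_of_nonneg (Real.exp_pos _).le, Real.norm_eq_abs, mul_comm]
    rcases lt_or_ge r (f x) with h | h
    · exact (mul_le_mul_of_nonneg_right (hnear x h) (Real.exp_pos _).le).trans
        (le_add_of_nonneg_right (by positivity))
    · exact (mul_le_mul (hK x) (exp_nat_mul_le hn h) (Real.exp_pos _).le hK0).trans
        (le_add_of_nonneg_left (by positivity))
  have hintr := (hint.const_mul (Real.exp (n * r) * Real.exp (-r))).const_mul K
  refine (norm_integral_le_of_norm_le ((hintn.const_mul ε).add hintr)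
    (Eventually.of_forall hbound)).trans_eq ?_
  simp only [Pi.add_apply]
  rw [integral_add (hintn.const_mul ε) hintr, integral_const_mul, integral_const_mul,
    integral_const_mul]

theorem tendsto_integral_exp_mul_div (hf : Measurable f) (hM : ∀ x, f x ≤ M)
    (hint : Integrable (fun x => Real.exp (f x)) μ) (hsup : ∀ r < M, 0 < μ {x | r < f x})
    {G : X → ℝ} (hG : AEStronglyMeasurable G μ) {K : ℝ} (hK : ∀ x, |G x| ≤ K) {L : ℝ}
    (hlim : Tendsto G (comap f (𝓝 M)) (𝓝 L)) :
    Tendsto (fun n : ℕ => (∫ x, Real.exp (n * f x) * G x ∂μ) / ∫ x, Real.exp (n * f x) ∂μ) atTop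
      (𝓝 L) := by
  have : NeZero μ := ⟨by rintro rfl; simpa using hsup (M - 1) (sub_one_lt M)⟩
  rw [Metric.tendsto_nhds]
  intro ε hε
  obtain ⟨r, hr, hnear⟩ : ∃ r < M, ∀ x, r < f x → |G x - L| ≤ ε / 2 := by
    obtain ⟨s, hs, hsub⟩ := hlim (Metric.closedBall_mem_nhds L (half_pos hε))
    obtain ⟨r, hr, hrs⟩ := exists_Ioc_subset_of_mem_nhds hs (exists_lt M)
    exact ⟨r, hr, fun x hx => hsub (hrs ⟨hx, hM x⟩)⟩
  have hKL : ∀ x, |G x - L| ≤ K + |L| := fun x => (abs_sub _ _).trans (by gcongr; exact hK x)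
  have htail := (tendsto_exp_div_integral_exp hf hM hint hsup hr).const_mul
    ((K + |L|) * (Real.exp (-r) * ∫ x, Real.exp (f x) ∂μ))
  rw [mul_zero] at htail
  filter_upwards [htail.eventually_lt_const (half_pos hε), eventually_ne_atTop 0] with n hn hn0
  have hintn := integrable_exp_nat_mul hf hM hint hn0
  have hpos := integral_exp_nat_mul_pos hf hM hint hn0
  have hcenter : ∫ x, Real.exp (n * f x) * (G x - L) ∂μ =
      ∫ x, Real.exp (n * f x) * G x ∂μ - (∫ x, Real.exp (n * f x) ∂μ) * L := by
    simp_rw [mul_sub]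
    rw [integral_sub (hintn.mul_bdd hG (Eventually.of_forall hK)) (hintn.mul_const L),
      integral_mul_const]
  have hdev := abs_integral_exp_mul_le hf hM hint (half_pos hε).le hnear hKL hn0
  rw [hcenter] at hdev
  rw [Real.dist_eq, div_sub' hpos.ne', abs_div, abs_of_pos hpos, div_lt_iff₀ hpos]
  rw [← mul_div_assoc, div_lt_iff₀ hpos] at hn
  linarith

end Laplace

/-! ### The Gibbs measure as a mixture of Bernoulli measures -/

section Mixture

variable {β : ℝ} {n : ℕ}

theorem neg_mul_hamiltonian (β : ℝ) (w : Fin n → ℤˣ) :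
    -β * hamiltonian w = β / (2 * n) * totalSpin w ^ 2 := by
  rw [hamiltonian, totalSpin, sq, Fintype.sum_mul_sum, Finset.sum_comm]
  ring

theorem exp_phiI_mul_bernoulli_real_pre (hn : n ≠ 0) (β x : ℝ) (w : Fin n → ℤˣ) :
    Real.exp (n * phiI β x) * (bernoulli (β * x) : Measure Shift).real (pre n ⁻¹' {w}) =
      Real.exp (-β * hamiltonian w) / 2 ^ n *
        Real.exp (-(n * β / 2) * (x - totalSpin w / n) ^ 2) := by
  have hcosh := Real.cosh_pos (β * x)
  -- Completing the square in `x`.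
  have hsquare : n * (-(β / 2 * x ^ 2)) + β * x * totalSpin w =
      -β * hamiltonian w + -(n * β / 2) * (x - totalSpin w / n) ^ 2 := by
    rw [neg_mul_hamiltonian]
    field_simp
    ring
  rw [bernoulli_real_pre, div_mul_eq_mul_div, ← Real.exp_add, ← hsquare, phiI, sub_eq_add_neg,
    mul_add, Real.exp_add, Real.exp_add, Real.exp_nat_mul, Real.exp_log hcosh, mul_pow]
  field_simp

theorem integral_exp_phiI_mul_bernoulli_real_pre (hn : n ≠ 0) (β : ℝ) (w : Fin n → ℤˣ) :
    ∫ x, Real.exp (n * phiI β x) * (bernoulli (β * x) : Measure Shift).real (pre n ⁻¹' {w}) =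
      √(Real.pi / (n * β / 2)) / 2 ^ n * Real.exp (-β * hamiltonian w) := by
  simp_rw [exp_phiI_mul_bernoulli_real_pre hn]
  rw [integral_const_mul,
    integral_sub_right_eq_self (fun x => Real.exp (-(n * β / 2) * x ^ 2)) (totalSpin w / n),
    integral_gaussian]
  ring

theorem measureReal_pre_eq_sum (μ : ProbabilityMeasure Shift) (s : Finset (Fin n → ℤˣ)) :
    (μ : Measure Shift).real (pre n ⁻¹' s) =
      ∑ w ∈ s, (μ : Measure Shift).real (pre n ⁻¹' {w}) :=
  (sum_measureReal_preimage_singleton s fun w _ =>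
    measurable_pre n (measurableSet_singleton w)).symm

theorem continuous_bernoulli_real_pre (B : Set (Fin n → ℤˣ)) :
    Continuous fun b => (bernoulli b : Measure Shift).real (pre n ⁻¹' B) := by
  obtain ⟨s, rfl⟩ := B.toFinite.exists_finset_coe
  simp_rw [measureReal_pre_eq_sum, bernoulli_real_pre]
  exact continuous_finsetSum _ fun w _ =>
    Continuous.div (by fun_prop) (by fun_prop) fun b => by positivity

theorem integrable_exp_phiI_mul_bernoulli_real (hβ : 0 < β) (hn : n ≠ 0) {N : ℕ}
    (B : Set (Fin N → ℤˣ)) :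
    Integrable fun x =>
      Real.exp (n * phiI β x) * (bernoulli (β * x) : Measure Shift).real (pre N ⁻¹' B) :=
  (integrable_exp_nat_mul (continuous_phiI β).measurable
    (fun x => (phiI_le hβ x).trans (sub_le_self β (by positivity)))
    (integrable_exp_phiI hβ) hn).mul_bdd
    ((continuous_bernoulli_real_pre B).comp (continuous_const_mul β)).aestronglyMeasurable
    (Eventually.of_forall fun _ => (abs_of_nonneg measureReal_nonneg).trans_le measureReal_le_one)

theorem gibbs_real_pre (β : ℝ) (w : Fin n → ℤˣ) :
    (gibbs n β : Measure Shift).real (pre n ⁻¹' {w}) =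
      Real.exp (-β * hamiltonian w) / ∑ v : Fin n → ℤˣ, Real.exp (-β * hamiltonian v) := by
  have hmeas := measurable_pre n (measurableSet_singleton w)
  have : 0 < ∑ v : Fin n → ℤˣ, Real.exp (-β * hamiltonian v) :=
    Finset.sum_pos (fun _ _ => Real.exp_pos _) Finset.univ_nonempty
  have hlintegral : gibbsAux n β (pre n ⁻¹' {w}) =
      ENNReal.ofReal (Real.exp (-β * hamiltonian w) / partitionFunction n β) * 2⁻¹ ^ n := by
    rw [gibbsAux, withDensity_apply _ hmeas, ← unif_pre n w, ← setLIntegral_const]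
    exact setLIntegral_congr_fun hmeas fun x hx => by rw [Set.mem_singleton_iff.1 hx]
  change (gibbsAux n β).real _ = _
  rw [measureReal_def, hlintegral, ENNReal.toReal_mul, ENNReal.toReal_ofReal
    (by unfold partitionFunction; positivity), partitionFunction]
  simp only [ENNReal.toReal_pow, ENNReal.toReal_inv, ENNReal.toReal_ofNat, inv_pow]
  field_simp

theorem gibbs_real_pre_eq_integral_div (hβ : 0 < β) (hn : n ≠ 0) (B : Set (Fin n → ℤˣ)) :
    (gibbs n β : Measure Shift).real (pre n ⁻¹' B) =
      (∫ x, Real.exp (n * phiI β x) * (bernoulli (β * x) : Measure Shift).real (pre n ⁻¹' B)) /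
        ∫ x, Real.exp (n * phiI β x) := by
  have : (0 : ℝ) < n := Nat.cast_pos.2 (Nat.pos_of_ne_zero hn)
  have hmix : ∀ s : Finset (Fin n → ℤˣ),
      ∫ x, Real.exp (n * phiI β x) * (bernoulli (β * x) : Measure Shift).real (pre n ⁻¹' s) =
        √(Real.pi / (n * β / 2)) / 2 ^ n * ∑ w ∈ s, Real.exp (-β * hamiltonian w) := fun s => by
    simp_rw [measureReal_pre_eq_sum, Finset.mul_sum]
    rw [integral_finsetSum _ fun w _ => integrable_exp_phiI_mul_bernoulli_real hβ hn {w}]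
    simp_rw [integral_exp_phiI_mul_bernoulli_real_pre hn]
  have htotal := hmix Finset.univ
  simp only [Finset.coe_univ, Set.preimage_univ, probReal_univ, mul_one] at htotal
  obtain ⟨s, rfl⟩ := B.toFinite.exists_finset_coe
  rw [measureReal_pre_eq_sum, hmix, htotal, mul_div_mul_left _ _ (by positivity)]
  simp_rw [gibbs_real_pre, Finset.sum_div]

theorem halfSum_real (μ ν : ProbabilityMeasure Shift) (A : Set Shift) :
    (halfSum μ ν : Measure Shift).real A =
      ((μ : Measure Shift).real A + (ν : Measure Shift).real A) / 2 := by
  change ((2⁻¹ : ℝ≥0∞) • ((μ : Measure Shift) + (ν : Measure Shift))).real A = _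
  rw [measureReal_ennreal_smul_apply, measureReal_add_apply, ENNReal.toReal_inv,
    ENNReal.toReal_ofNat, inv_mul_eq_div]

theorem halfSum_self (μ : ProbabilityMeasure Shift) : halfSum μ μ = μ := by
  refine ProbabilityMeasure.toMeasure_injective (Measure.ext fun A _ => ?_)
  rw [← measureReal_eq_measureReal_iff, halfSum_real, add_self_div_two]

theorem halfSum_comm (μ ν : ProbabilityMeasure Shift) : halfSum μ ν = halfSum ν μ := by
  refine ProbabilityMeasure.toMeasure_injective (Measure.ext fun A _ => ?_)
  rw [← measureReal_eq_measureReal_iff, halfSum_real, halfSum_real, add_comm]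

theorem halfSum_bernoulli_abs (b : ℝ) :
    halfSum (bernoulli |b|) (bernoulli (-|b|)) = halfSum (bernoulli b) (bernoulli (-b)) := by
  rcases abs_choice b with h | h <;> rw [h]
  rw [neg_neg, halfSum_comm]

theorem continuous_halfSum_bernoulli_real_pre (B : Set (Fin n → ℤˣ)) :
    Continuous fun b =>
      (halfSum (bernoulli b) (bernoulli (-b)) : Measure Shift).real (pre n ⁻¹' B) := by
  simp_rw [halfSum_real]
  exact ((continuous_bernoulli_real_pre B).add
    ((continuous_bernoulli_real_pre B).comp continuous_neg)).div_const 2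

theorem integral_exp_phiI_mul_halfSum_real (hβ : 0 < β) (hn : n ≠ 0) {N : ℕ}
    (B : Set (Fin N → ℤˣ)) :
    ∫ x, Real.exp (n * phiI β x) * (halfSum (bernoulli (β * x)) (bernoulli (-(β * x))) :
        Measure Shift).real (pre N ⁻¹' B) =
      ∫ x, Real.exp (n * phiI β x) * (bernoulli (β * x) : Measure Shift).real (pre N ⁻¹' B) := by
  set F : ℝ → ℝ := fun x =>
    Real.exp (n * phiI β x) * (bernoulli (β * x) : Measure Shift).real (pre N ⁻¹' B) with hF
  have hint : Integrable F := integrable_exp_phiI_mul_bernoulli_real hβ hn B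
  calc _ = ∫ x, (F x + F (-x)) / 2 := by
        simp only [hF, halfSum_real, phiI_neg, mul_neg, ← mul_add, mul_div_assoc]
    _ = ∫ x, F x := by
        rw [integral_div, integral_add hint hint.comp_neg, integral_neg_eq_self, add_self_div_two]

theorem gibbs_real_pre_eq_integral_halfSum_div (hβ : 0 < β) (hn : n ≠ 0) {N : ℕ} (hN : N ≤ n)
    (B : Set (Fin N → ℤˣ)) :
    (gibbs n β : Measure Shift).real (pre N ⁻¹' B) =
      (∫ x, Real.exp (n * phiI β x) * (halfSum (bernoulli (β * x)) (bernoulli (-(β * x))) :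
          Measure Shift).real (pre N ⁻¹' B)) /
        ∫ x, Real.exp (n * phiI β x) := by
  have hpre : pre N ⁻¹' B = pre n ⁻¹' {w | (fun i => w (Fin.castLE hN i)) ∈ B} := rfl
  rw [integral_exp_phiI_mul_halfSum_real hβ hn, hpre, gibbs_real_pre_eq_integral_div hβ hn]

theorem tendsto_gibbs (hβ : 0 < β) {ξ : ℝ} (hξ : ξ ∈ Set.Icc (0 : ℝ) 1)
    (hmax : IsMaxOn (phiI β) (Set.Icc 0 1) ξ) :
    Tendsto (fun n : ℕ => gibbs n β) atTop
      (𝓝 (halfSum (bernoulli (β * ξ)) (bernoulli (-(β * ξ))))) := by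
  refine tendsto_of_tendsto_pre fun N B => ?_
  set G : ℝ → ℝ := fun x => (halfSum (bernoulli (β * x)) (bernoulli (-(β * x))) :
    Measure Shift).real (pre N ⁻¹' B) with hG
  have hGcont : Continuous G :=
    (continuous_halfSum_bernoulli_real_pre B).comp (continuous_const_mul β)
  have hGmax : Set.MapsTo G (phiI β ⁻¹' {phiI β ξ}) {G ξ} := fun x hx => by
    simp only [hG, Set.mem_singleton_iff, ← abs_eq_of_phiI_eq hβ hξ.1 hmax hx]
    rw [← halfSum_bernoulli_abs (β * x), abs_mul, abs_of_pos hβ]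
  have hGlim : Tendsto G (comap (phiI β) (𝓝 (phiI β ξ))) (𝓝 (G ξ)) := by
    rw [(isProperMap_phiI hβ).isClosedMap.comap_nhds_eq (continuous_phiI β), ← nhdsSet_singleton]
    exact hGcont.tendsto_nhdsSet hGmax
  have hsup : ∀ r < phiI β ξ, 0 < volume {x | r < phiI β x} := fun r hr =>
    (isOpen_lt continuous_const (continuous_phiI β)).measure_pos _ ⟨ξ, hr⟩
  refine (tendsto_integral_exp_mul_div (continuous_phiI β).measurable
    (phiI_le_of_isMaxOn hβ hmax) (integrable_exp_phiI hβ) hsup hGcont.aestronglyMeasurable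
    (fun x => (abs_of_nonneg measureReal_nonneg).trans_le measureReal_le_one) hGlim).congr' ?_
  filter_upwards [eventually_ge_atTop N, eventually_ne_atTop 0] with n hN hn
  exact (gibbs_real_pre_eq_integral_halfSum_div hβ hn hN B).symm

end Mixture

end CurieWeiss

theorem theorem1p1 (β : ℝ) (hβ : 0 < β) :
    ∃ ξ ∈ Set.Icc (0 : ℝ) 1,
      IsMaxOn (CurieWeiss.phiI β) (Set.Icc 0 1) ξ ∧
      (∀ y ∈ Set.Icc (0 : ℝ) 1, IsMaxOn (CurieWeiss.phiI β) (Set.Icc 0 1) y → y = ξ) ∧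
      ∃ μt : ℝ → ProbabilityMeasure CurieWeiss.Shift,
        (∀ b : ℝ, CurieWeiss.IsDynamicalGibbsMeasure (b • CurieWeiss.psi) (μt b)) ∧
        (∀ b : ℝ, μt b = CurieWeiss.bernoulli b) ∧
        μt 0 = CurieWeiss.unif ∧
        (β ≤ 1 → Tendsto (fun n : ℕ => CurieWeiss.gibbs n β) atTop (𝓝 (μt 0))) ∧
        (1 < β → Tendsto (fun n : ℕ => CurieWeiss.gibbs n β) atTop
          (𝓝 (CurieWeiss.halfSum (μt (β * ξ)) (μt (-(β * ξ)))))) := by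
  obtain ⟨ξ, hξ, hmax⟩ := CurieWeiss.exists_isMaxOn_phiI β
  refine ⟨ξ, hξ, hmax, fun y hy hymax => CurieWeiss.eq_of_isMaxOn_phiI hβ hy hξ hymax hmax,
    CurieWeiss.bernoulli, CurieWeiss.isDynamicalGibbsMeasure_bernoulli, fun _ => rfl,
    CurieWeiss.bernoulli_zero, fun hβ1 => ?_, fun _ => CurieWeiss.tendsto_gibbs hβ hξ hmax⟩
  have h := CurieWeiss.tendsto_gibbs hβ (Set.left_mem_Icc.2 zero_le_one)
    (CurieWeiss.isMaxOn_phiI_zero hβ hβ1)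
  rwa [mul_zero, neg_zero, CurieWeiss.halfSum_self] at h
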